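/- Let $m\ge 2$ and let $P,Q\subset\mathbb R^m$ be compact convex polyhedra with nonempty interior (a convex polyhedron is an intersection of finitely many closed half-spaces). For a unit vector $n$ let $\Gamma_P(n)=\{x\in P:\langle n,y\rangle\le\langle n,x\rangle\text{ for all }y\in P\}$ be the face of $P$ with outward normal $n$, and define $\Gamma_Q(n)$ in the same way; such a face may have any dimension from $0$ to $m-1$. Let $\mathcal N$ be the set of all unit vectors $n$ for which at least one of the faces $\Gamma_P(n)$, $\Gamma_Q(n)$ has dimension $m-1$, that is, the set of unit outward normals to the $(m-1)$-dimensional faces of $P$ and of $Q$. Suppose that $$\mathrm{Vol}_{m-1}\,\Gamma_P(n)\ \ge\ \mathrm{Vol}_{m-1}\,\Gamma_Q(n)\qquad\text{for every } n\in\mathcal N .$$ Then $\mathrm{Vol}_m\,P\ge \mathrm{Vol}_m\,Q$. -/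

import Mathlib

open MeasureTheory

namespace BlaschkePolyhedra

/-- A convex polyhedron in `ℝ^m`: the intersection of finitely many closed half-spaces
`{x | ⟪a, x⟫ ≤ b}`, `a ≠ 0`. (Compactness is imposed separately; a compact convex polyhedron is
the same thing as a convex polytope.) -/
def IsConvexPolyhedron {m : ℕ} (P : Set (EuclideanSpace ℝ (Fin m))) : Prop :=
  ∃ s : Finset (EuclideanSpace ℝ (Fin m) × ℝ),
    (∀ h ∈ s, h.1 ≠ 0) ∧ P = {x | ∀ h ∈ s, inner ℝ h.1 x ≤ h.2}

/-- The face of `P` with outward normal `n`: the points of `P` at which the linear functional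
`⟪n, ·⟫` attains its maximum over `P`. It may have any dimension. -/
def face {m : ℕ} (P : Set (EuclideanSpace ℝ (Fin m))) (n : EuclideanSpace ℝ (Fin m)) :
    Set (EuclideanSpace ℝ (Fin m)) :=
  {x | x ∈ P ∧ ∀ y ∈ P, inner ℝ n y ≤ inner ℝ n x}

/-- The set of unit outward normals to the `(m - 1)`-dimensional faces of `P`: the unit vectors `n`
such that the affine hull of the face of `P` with outward normal `n` has dimension `m - 1`. -/
def facetNormals {m : ℕ} (P : Set (EuclideanSpace ℝ (Fin m))) :
    Set (EuclideanSpace ℝ (Fin m)) :=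
  {n | ‖n‖ = 1 ∧ Module.finrank ℝ (affineSpan ℝ (face P n)).direction + 1 = m}

end BlaschkePolyhedra

namespace BlaschkePolyhedra

open scoped ENNReal Pointwise Topology
open Filter

/-! Write p, q for the volumes of P, Q, with 0 moved into the interior of P, and h for the support
function of P. Let S be a finite set of unit normals whose supporting half-spaces cut out Q. Two
estimates are compared. Essentially disjoint cones from 0 over faces of P give ∑ h(n) |Γ_P(n)| ≤ m p
(`sum_support_mul_face_le_volume`). Minkowski's first inequality, in a logarithmic form
(`minkowski_log_le_sum`), gives m q + q (log p - log q) ≤ ∑ h(n) |Γ_Q(n)|. Both sums run over S.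
Apply the second estimate to c P with c = q / p. The face hypothesis and the first estimate bound
its right side by c m p = m q, so |c P| ≤ q, that is c ^ (m - 1) ≤ 1, and q ≤ p because m ≥ 2.
Normals in S that are not facet normals of Q contribute zero. Minkowski's inequality is the
derivative at t = 0 of the Brunn–Minkowski bound for |Q + t P|, itself a consequence of
Prékopa–Leindler. -/

/-! ### Brunn–Minkowski on the line -/

/-- With u = max A and v = min B, the translates A + v and u + B lie in C and meet only at u + v. -/
theorem volume_add_volume_le_of_isCompact {A B C : Set ℝ} (hA : IsCompact A) (hB : IsCompact B)
    (hA0 : A.Nonempty) (hB0 : B.Nonempty) (h : ∀ x ∈ A, ∀ y ∈ B, x + y ∈ C) :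
    volume A + volume B ≤ volume C := by
  obtain ⟨u, huA, hu⟩ := hA.exists_isGreatest hA0
  obtain ⟨v, hvB, hv⟩ := hB.exists_isLeast hB0
  have h1 : volume ((fun x => x + v) '' A) = volume A := by
    simp [Set.image_add_right, measure_preimage_add_right]
  have h2 : volume ((fun x => u + x) '' B) = volume B := by
    simp [Set.image_add_left, measure_preimage_add]
  have hd : AEDisjoint volume ((fun x => x + v) '' A) ((fun x => u + x) '' B) := by
    refine measure_mono_null (t := {u + v}) ?_ (by simp)
    rintro z ⟨⟨x, hx, rfl⟩, y, hy, hxy⟩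
    have h3 := hu hx
    have h4 := hv hy
    simp only at hxy
    simp only [Set.mem_singleton_iff]
    linarith
  have hm : NullMeasurableSet ((fun x => u + x) '' B) volume :=
    (hB.image (by fun_prop)).measurableSet.nullMeasurableSet
  rw [← h1, ← h2, ← measure_union₀ hm hd]
  refine measure_mono ?_
  rintro z (⟨x, hx, rfl⟩ | ⟨y, hy, rfl⟩)
  · exact h x hx v hvB
  · exact h u huA y hy

theorem volume_add_volume_le {A B C : Set ℝ} (hA : MeasurableSet A) (hB : MeasurableSet B)
    (hA0 : A.Nonempty) (hB0 : B.Nonempty) (h : ∀ x ∈ A, ∀ y ∈ B, x + y ∈ C) :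
    volume A + volume B ≤ volume C := by
  obtain ⟨x₀, hx₀⟩ := hA0
  obtain ⟨y₀, hy₀⟩ := hB0
  have key : ∀ K ⊆ A, IsCompact K → ∀ L ⊆ B, IsCompact L → volume K + volume L ≤ volume C := by
    intro K hKA hK L hLB hL
    -- The inserted points keep the sets nonempty, so that K and L may be empty in the suprema of
    -- inner regularity.
    have h' := volume_add_volume_le_of_isCompact (C := C) (hK.insert x₀) (hL.insert y₀)
      ⟨x₀, by simp⟩ ⟨y₀, by simp⟩ (fun x hx y hy =>
        h x (Set.insert_subset hx₀ hKA hx) y (Set.insert_subset hy₀ hLB hy))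
    exact (add_le_add (measure_mono (Set.subset_insert _ _))
      (measure_mono (Set.subset_insert _ _))).trans h'
  rw [hA.measure_eq_iSup_isCompact, hB.measure_eq_iSup_isCompact]
  simp only [iSup_and']
  exact ENNReal.biSup_add_biSup_le' ⟨∅, by simp⟩ ⟨∅, by simp⟩
    fun K hK L hL => key K hK.1 hK.2 L hL.1 hL.2

theorem mul_volume_add_mul_volume_le {A B C : Set ℝ} {a b : ℝ} (ha : 0 < a) (hb : 0 < b)
    (hA : MeasurableSet A) (hB : MeasurableSet B) (hA0 : A.Nonempty) (hB0 : B.Nonempty)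
    (h : ∀ x ∈ A, ∀ y ∈ B, a * x + b * y ∈ C) :
    ENNReal.ofReal a * volume A + ENNReal.ofReal b * volume B ≤ volume C := by
  have h1 := volume_add_volume_le (C := C) (hA.const_smul₀ a) (hB.const_smul₀ b)
    (hA0.image _) (hB0.image _) (by
      rintro _ ⟨x, hx, rfl⟩ _ ⟨y, hy, rfl⟩
      exact h x hx y hy)
  simpa [Measure.addHaar_smul, abs_of_pos ha, abs_of_pos hb] using h1

/-! ### The Prékopa–Leindler inequality -/

theorem ennreal_geom_mean_le_arith_mean {a b : ℝ} (ha : 0 < a) (hb : 0 < b) (hab : a + b = 1)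
    (x y : ℝ≥0∞) : x ^ a * y ^ b ≤ ENNReal.ofReal a * x + ENNReal.ofReal b * y := by
  rcases eq_or_ne x ∞ with rfl | hx
  · simp [ENNReal.mul_top, ha]
  rcases eq_or_ne y ∞ with rfl | hy
  · simp [ENNReal.mul_top, hb]
  lift x to NNReal using hx
  lift y to NNReal using hy
  have := NNReal.geom_mean_le_arith_mean2_weighted a.toNNReal b.toNNReal x y (by
    rw [← Real.toNNReal_add ha.le hb.le, hab, Real.toNNReal_one])
  rw [Real.coe_toNNReal _ ha.le, Real.coe_toNNReal _ hb.le] at this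
  rw [← ENNReal.coe_rpow_of_nonneg _ ha.le, ← ENNReal.coe_rpow_of_nonneg _ hb.le]
  simpa only [ENNReal.ofReal, ← ENNReal.coe_mul, ← ENNReal.coe_add, ENNReal.coe_le_coe] using this

theorem lintegral_eq_lintegral_meas_lt_of_le_one {α : Type*} [MeasurableSpace α] (μ : Measure α)
    {f : α → ℝ≥0∞} (hf : Measurable f) (h1 : ∀ x, f x ≤ 1) :
    ∫⁻ x, f x ∂μ = ∫⁻ r in Set.Ioi (0 : ℝ), μ {x | ENNReal.ofReal r < f x} := by
  have hfin : ∀ x, f x ≠ ∞ := fun x => ((h1 x).trans_lt ENNReal.one_lt_top).ne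
  have h := lintegral_eq_lintegral_meas_lt μ (f := fun x => (f x).toReal)
    (Filter.Eventually.of_forall fun _ => ENNReal.toReal_nonneg) hf.ennreal_toReal.aemeasurable
  simp only [ENNReal.ofReal_toReal (hfin _)] at h
  rw [h]
  refine setLIntegral_congr_fun measurableSet_Ioi fun r hr => ?_
  simp only [ENNReal.ofReal_lt_iff_lt_toReal (le_of_lt hr) (hfin _)]

/-- For 0 < r < 1 the sets {f > r} and {g > r} are nonempty because both suprema are 1, and a {f >
r} + b {g > r} ⊆ {h > r}. Brunn–Minkowski on the line, integrated over r, gives the bound. -/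
theorem lintegral_add_le_of_iSup_eq_one {a b : ℝ} (ha : 0 < a) (hb : 0 < b) (hab : a + b = 1)
    {f g h : ℝ → ℝ≥0∞} (hf : Measurable f) (hg : Measurable g) (hh : Measurable h)
    (hf1 : ⨆ x, f x = 1) (hg1 : ⨆ x, g x = 1)
    (H : ∀ x y, f x ^ a * g y ^ b ≤ h (a * x + b * y)) :
    ENNReal.ofReal a * (∫⁻ x, f x) + ENNReal.ofReal b * (∫⁻ x, g x) ≤ ∫⁻ x, h x := by
  have hfle : ∀ x, f x ≤ 1 := fun x => hf1 ▸ le_iSup f x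
  have hgle : ∀ x, g x ≤ 1 := fun x => hg1 ▸ le_iSup g x
  have hmeas : ∀ {u : ℝ → ℝ≥0∞}, Measurable u →
      Measurable fun r : ℝ => volume {x | ENNReal.ofReal r < u x} := by
    intro u _
    refine Antitone.measurable fun r s hrs => measure_mono fun x hx => ?_
    exact (ENNReal.ofReal_le_ofReal hrs).trans_lt hx
  calc ENNReal.ofReal a * (∫⁻ x, f x) + ENNReal.ofReal b * (∫⁻ x, g x)
      = ∫⁻ r in Set.Ioi (0 : ℝ), (ENNReal.ofReal a * volume {x | ENNReal.ofReal r < f x}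
          + ENNReal.ofReal b * volume {x | ENNReal.ofReal r < g x}) := by
        rw [lintegral_eq_lintegral_meas_lt_of_le_one volume hf hfle,
          lintegral_eq_lintegral_meas_lt_of_le_one volume hg hgle,
          lintegral_add_left ((hmeas hf).const_mul _), lintegral_const_mul _ (hmeas hf),
          lintegral_const_mul _ (hmeas hg)]
    _ ≤ ∫⁻ r in Set.Ioi (0 : ℝ), volume {x | ENNReal.ofReal r < min (h x) 1} := by
        refine setLIntegral_mono' measurableSet_Ioi fun r hr => ?_
        rcases lt_or_ge r 1 with hr1 | hr1
        · have hr1' : ENNReal.ofReal r < 1 := by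
            simpa using (ENNReal.ofReal_lt_ofReal_iff one_pos).2 hr1
          have hr0 : ENNReal.ofReal r ≠ 0 := by simpa using hr
          refine mul_volume_add_mul_volume_le ha hb (measurableSet_lt measurable_const hf)
            (measurableSet_lt measurable_const hg) (lt_iSup_iff.1 (hr1'.trans_eq hf1.symm))
            (lt_iSup_iff.1 (hr1'.trans_eq hg1.symm)) ?_
          intro x hx y hy
          refine lt_min (lt_of_lt_of_le ?_ (H x y)) hr1'
          calc ENNReal.ofReal r = ENNReal.ofReal r ^ a * ENNReal.ofReal r ^ b := by
                rw [← ENNReal.rpow_add _ _ hr0 ENNReal.ofReal_ne_top, hab, ENNReal.rpow_one]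
            _ < f x ^ a * g y ^ b :=
                ENNReal.mul_lt_mul (ENNReal.rpow_lt_rpow hx ha) (ENNReal.rpow_lt_rpow hy hb)
        · have hr1' : 1 ≤ ENNReal.ofReal r := by simpa using ENNReal.ofReal_le_ofReal hr1
          have e : ∀ {u : ℝ → ℝ≥0∞}, (∀ x, u x ≤ 1) → {x | ENNReal.ofReal r < u x} = ∅ :=
            fun hu => Set.eq_empty_of_forall_notMem fun x hx =>
              absurd (hr1'.trans_lt hx) (hu x).not_gt
          simp [e hfle, e hgle]
    _ = ∫⁻ x, min (h x) 1 :=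
        (lintegral_eq_lintegral_meas_lt_of_le_one volume (hh.min measurable_const)
          fun x => min_le_right _ _).symm
    _ ≤ ∫⁻ x, h x := lintegral_mono fun x => min_le_left _ _

/-- Dividing f and g by their suprema, and h by the matching product of powers, reduces to suprema
1; the weighted AM–GM inequality then turns the sum into a product. -/
theorem prekopa_leindler_real_of_bounded {a b : ℝ} (ha : 0 < a) (hb : 0 < b) (hab : a + b = 1)
    {f g h : ℝ → ℝ≥0∞} (hf : Measurable f) (hg : Measurable g) (hh : Measurable h)
    (hf1 : ⨆ x, f x ≠ ∞) (hg1 : ⨆ x, g x ≠ ∞)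
    (H : ∀ x y, f x ^ a * g y ^ b ≤ h (a * x + b * y)) :
    (∫⁻ x, f x) ^ a * (∫⁻ x, g x) ^ b ≤ ∫⁻ x, h x := by
  set α := ⨆ x, f x with hα
  set β := ⨆ x, g x with hβ
  rcases eq_or_ne α 0 with h0 | hα0
  · have : ∀ x, f x = 0 := fun x => le_antisymm (h0 ▸ le_iSup f x) zero_le
    simp [this, ENNReal.zero_rpow_of_pos ha]
  rcases eq_or_ne β 0 with h0 | hβ0
  · have : ∀ x, g x = 0 := fun x => le_antisymm (h0 ▸ le_iSup g x) zero_le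
    simp [this, ENNReal.zero_rpow_of_pos hb]
  set c := α ^ a * β ^ b with hc
  have hαa0 : α ^ a ≠ 0 := by simp [hα0, hf1]
  have hβb0 : β ^ b ≠ 0 := by simp [hβ0, hg1]
  have hαat : α ^ a ≠ ∞ := ENNReal.rpow_ne_top_of_nonneg ha.le hf1
  have hβbt : β ^ b ≠ ∞ := ENNReal.rpow_ne_top_of_nonneg hb.le hg1
  have hc0 : c ≠ 0 := mul_ne_zero hαa0 hβb0
  have hct : c ≠ ∞ := ENNReal.mul_ne_top hαat hβbt
  have hcinv : c⁻¹ = α⁻¹ ^ a * β⁻¹ ^ b := by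
    rw [hc, ENNReal.mul_inv (Or.inl hαa0) (Or.inl hαat), ENNReal.inv_rpow, ENNReal.inv_rpow]
  have key := lintegral_add_le_of_iSup_eq_one ha hb hab (hf.const_mul α⁻¹) (hg.const_mul β⁻¹)
    (hh.const_mul c⁻¹) (by rw [← ENNReal.mul_iSup, ← hα, ENNReal.inv_mul_cancel hα0 hf1])
    (by rw [← ENNReal.mul_iSup, ← hβ, ENNReal.inv_mul_cancel hβ0 hg1]) (by
      intro x y
      rw [ENNReal.mul_rpow_of_nonneg _ _ ha.le, ENNReal.mul_rpow_of_nonneg _ _ hb.le,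
        mul_mul_mul_comm, ← hcinv]
      gcongr
      exact H x y)
  have key2 := (ennreal_geom_mean_le_arith_mean ha hb hab _ _).trans key
  rw [lintegral_const_mul _ hf, lintegral_const_mul _ hg, lintegral_const_mul _ hh,
    ENNReal.mul_rpow_of_nonneg _ _ ha.le, ENNReal.mul_rpow_of_nonneg _ _ hb.le,
    mul_mul_mul_comm, ← hcinv] at key2
  exact (ENNReal.mul_le_mul_iff_right (ENNReal.inv_ne_zero.2 hct)
    (ENNReal.inv_ne_top.2 hc0)).1 key2

theorem tendsto_lintegral_min_natCast {α : Type*} [MeasurableSpace α] (μ : Measure α)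
    {f : α → ℝ≥0∞} (hf : Measurable f) :
    Filter.Tendsto (fun N : ℕ => ∫⁻ x, min (f x) N ∂μ) Filter.atTop (nhds (∫⁻ x, f x ∂μ)) := by
  refine lintegral_tendsto_of_tendsto_of_monotone
    (fun N => (hf.min measurable_const).aemeasurable) (Filter.Eventually.of_forall fun x N M hNM =>
      min_le_min le_rfl (by exact_mod_cast hNM)) (Filter.Eventually.of_forall fun x => ?_)
  have := (tendsto_const_nhds (x := f x)).min ENNReal.tendsto_nat_nhds_top
  simpa using this

theorem prekopa_leindler_real {a b : ℝ} (ha : 0 < a) (hb : 0 < b) (hab : a + b = 1)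
    {f g h : ℝ → ℝ≥0∞} (hf : Measurable f) (hg : Measurable g) (hh : Measurable h)
    (H : ∀ x y, f x ^ a * g y ^ b ≤ h (a * x + b * y)) :
    (∫⁻ x, f x) ^ a * (∫⁻ x, g x) ^ b ≤ ∫⁻ x, h x := by
  rcases eq_or_ne (∫⁻ x, f x) 0 with h0 | hf0
  · simp [h0, ENNReal.zero_rpow_of_pos ha]
  rcases eq_or_ne (∫⁻ x, g x) 0 with h0 | hg0
  · simp [h0, ENNReal.zero_rpow_of_pos hb]
  have hfa : (∫⁻ x, f x) ^ a ≠ 0 := by simp [hf0, ha.le]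
  have hgb : (∫⁻ x, g x) ^ b ≠ 0 := by simp [hg0, hb.le]
  -- Truncate f and g at N and let N grow. Nonzero integrals exclude the product 0 · ∞, where
  -- multiplication is discontinuous.
  refine le_of_tendsto' (ENNReal.Tendsto.mul
    ((tendsto_lintegral_min_natCast volume hf).ennrpow_const a) (Or.inl hfa)
    ((tendsto_lintegral_min_natCast volume hg).ennrpow_const b) (Or.inl hgb)) fun N => ?_
  refine prekopa_leindler_real_of_bounded ha hb hab (hf.min measurable_const)
    (hg.min measurable_const) hh ?_ ?_ fun x y => le_trans ?_ (H x y)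
  · exact ((iSup_le fun x => min_le_right _ _).trans_lt (ENNReal.natCast_lt_top N)).ne
  · exact ((iSup_le fun x => min_le_right _ _).trans_lt (ENNReal.natCast_lt_top N)).ne
  · gcongr <;> exact min_le_left _ _

theorem lintegral_fin_cons {n : ℕ} {f : (Fin (n + 1) → ℝ) → ℝ≥0∞} (hf : Measurable f) :
    ∫⁻ x, f x = ∫⁻ s : ℝ, ∫⁻ y : Fin n → ℝ, f (Fin.cons s y) := by
  have h := (volume_preserving_piFinSuccAbove (fun _ : Fin (n + 1) => ℝ) 0).symm
  rw [← h.lintegral_comp hf, Measure.volume_eq_prod, lintegral_prod _ (by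
    exact (hf.comp h.measurable).aemeasurable)]
  simp [MeasurableEquiv.piFinSuccAbove, Fin.insertNthEquiv]

/-- Induction by Tonelli: the inductive hypothesis on slices says that the partial integrals, as
functions of the first coordinate, satisfy the one-dimensional hypothesis. -/
theorem prekopa_leindler {a b : ℝ} (ha : 0 < a) (hb : 0 < b) (hab : a + b = 1) (n : ℕ)
    {f g h : (Fin n → ℝ) → ℝ≥0∞} (hf : Measurable f) (hg : Measurable g) (hh : Measurable h)
    (H : ∀ x y, f x ^ a * g y ^ b ≤ h (a • x + b • y)) :
    (∫⁻ x, f x) ^ a * (∫⁻ x, g x) ^ b ≤ ∫⁻ x, h x := by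
  induction n with
  | zero =>
    have e : ∀ u : (Fin 0 → ℝ) → ℝ≥0∞, ∫⁻ x, u x = u default := by
      intro u
      rw [lintegral_unique, volume_pi, Measure.pi_univ]
      simp only [Finset.univ_eq_empty, Finset.prod_empty, mul_one]
      exact congrArg u (Subsingleton.elim _ _)
    rw [e, e, e]
    convert H default default using 2
  | succ n ih =>
    have hcons : Measurable fun p : ℝ × (Fin n → ℝ) => (Fin.cons p.1 p.2 : Fin (n + 1) → ℝ) := by
      refine measurable_pi_lambda _ fun i => ?_
      refine Fin.cases ?_ (fun j => ?_) i
      · simpa using measurable_fst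
      · simpa [Function.comp_def] using (measurable_pi_apply j).comp (measurable_snd (α := ℝ))
    have hm : ∀ {u : (Fin (n + 1) → ℝ) → ℝ≥0∞}, Measurable u →
        Measurable fun s : ℝ => ∫⁻ y : Fin n → ℝ, u (Fin.cons s y) := fun hu =>
      (hu.comp hcons).lintegral_prod_right'
    have hm' : ∀ {u : (Fin (n + 1) → ℝ) → ℝ≥0∞}, Measurable u → ∀ s : ℝ,
        Measurable fun y : Fin n → ℝ => u (Fin.cons s y) := fun hu s =>
      (hu.comp hcons).comp measurable_prodMk_left
    rw [lintegral_fin_cons hf, lintegral_fin_cons hg, lintegral_fin_cons hh]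
    refine prekopa_leindler_real ha hb hab (hm hf) (hm hg) (hm hh) fun s t => ?_
    refine ih (hm' hf s) (hm' hg t) (hm' hh _) fun x y => (H _ _).trans_eq ?_
    congr 1
    ext i
    refine Fin.cases ?_ (fun j => ?_) i <;> simp

/-- Multiplicative form of the Brunn–Minkowski inequality. -/
theorem volume_rpow_mul_volume_rpow_le {a b : ℝ} (ha : 0 < a) (hb : 0 < b) (hab : a + b = 1)
    {n : ℕ} {A B C : Set (EuclideanSpace ℝ (Fin n))} (hA : MeasurableSet A)
    (hB : MeasurableSet B) (hC : MeasurableSet C)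
    (H : ∀ x ∈ A, ∀ y ∈ B, a • x + b • y ∈ C) :
    volume A ^ a * volume B ^ b ≤ volume C := by
  have hp := PiLp.volume_preserving_toLp (Fin n)
  have e : ∀ {S : Set (EuclideanSpace ℝ (Fin n))}, MeasurableSet S →
      ∫⁻ x : Fin n → ℝ, (WithLp.toLp 2 ⁻¹' S).indicator 1 x = volume S := by
    intro S hS
    rw [lintegral_indicator_one (hp.measurable hS), hp.measure_preimage hS.nullMeasurableSet]
  have hm : ∀ {S : Set (EuclideanSpace ℝ (Fin n))}, MeasurableSet S →
      Measurable ((WithLp.toLp 2 ⁻¹' S).indicator (1 : (Fin n → ℝ) → ℝ≥0∞)) := fun hS =>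
    measurable_one.indicator (hp.measurable hS)
  rw [← e hA, ← e hB, ← e hC]
  refine prekopa_leindler ha hb hab n (hm hA) (hm hB) (hm hC) fun x y => ?_
  by_cases hx : x ∈ WithLp.toLp 2 ⁻¹' A
  · by_cases hy : y ∈ WithLp.toLp 2 ⁻¹' B
    · have : a • x + b • y ∈ WithLp.toLp 2 ⁻¹' C := by
        simpa using H _ hx _ hy
      simp only [Set.indicator_of_mem hx, Set.indicator_of_mem hy, Set.indicator_of_mem this]
      simp
    · simp [Set.indicator_of_notMem hy, hb]
  · simp [Set.indicator_of_notMem hx, ha]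

/-! ### Hyperplane slices and faces -/

/-- Orthogonal coordinates adapted to a unit vector `n`: the hyperplane `n^⊥` is parametrized by an
isometry `ι`, and `(s, y) ↦ s • n + ι y` preserves volume. -/
theorem exists_isometry_orthogonal {k : ℕ} {n : EuclideanSpace ℝ (Fin (k + 1))} (hn : ‖n‖ = 1) :
    ∃ (ι : EuclideanSpace ℝ (Fin k) →ₗᵢ[ℝ] EuclideanSpace ℝ (Fin (k + 1)))
      (π : EuclideanSpace ℝ (Fin (k + 1)) → EuclideanSpace ℝ (Fin k)),
      Continuous π ∧ (∀ y, inner ℝ n (ι y) = 0) ∧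
      (∀ x, (inner ℝ n x : ℝ) • n + ι (π x) = x) ∧
      MeasurePreserving (fun p : ℝ × EuclideanSpace ℝ (Fin k) => p.1 • n + ι p.2) := by
  obtain ⟨b, hb⟩ := Orthonormal.exists_orthonormalBasis_extension_of_card_eq (𝕜 := ℝ)
    (E := EuclideanSpace ℝ (Fin (k + 1))) (ι := Fin (k + 1)) (by simp)
    (v := fun _ => n) (s := {0}) ⟨fun i => by simpa using hn, fun i j hij =>
      (hij (Subsingleton.elim i j)).elim⟩
  have hb0 : b 0 = n := hb 0 rfl
  let f : EuclideanSpace ℝ (Fin k) →ₗ[ℝ] EuclideanSpace ℝ (Fin (k + 1)) :=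
    { toFun := fun y => WithLp.toLp 2 (Fin.cons 0 y.ofLp)
      map_add' := fun x y => by
        ext i
        refine Fin.cases ?_ (fun j => ?_) i <;> simp
      map_smul' := fun c x => by
        ext i
        refine Fin.cases ?_ (fun j => ?_) i <;> simp }
  have hf : ∀ y, ‖f y‖ = ‖y‖ := fun y => by
    simp [f, EuclideanSpace.norm_eq, Fin.sum_univ_succ]
  let ι := b.repr.symm.toLinearIsometry.comp (⟨f, hf⟩ : _ →ₗᵢ[ℝ] _)
  have hsplit : ∀ (s : ℝ) (y : EuclideanSpace ℝ (Fin k)),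
      s • n + ι y = b.repr.symm (WithLp.toLp 2 (Fin.cons s y.ofLp)) := by
    intro s y
    have h1 : n = b.repr.symm (EuclideanSpace.single 0 1) := by simp [hb0]
    have h2 : ι y = b.repr.symm (f y) := rfl
    rw [h2, h1, ← map_smul, ← map_add]
    congr 1
    ext i
    refine Fin.cases ?_ (fun j => ?_) i <;> simp [f]
  refine ⟨ι, fun x => WithLp.toLp 2 fun j => b.repr x j.succ, by fun_prop, fun y => ?_,
    fun x => ?_, ?_⟩
  · have h2 : ι y = b.repr.symm (f y) := rfl
    rw [h2, ← hb0, ← b.repr_apply_apply]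
    simp [f]
  · rw [hsplit, LinearIsometryEquiv.symm_apply_eq]
    ext i
    refine Fin.cases ?_ (fun j => ?_) i
    · simp [b.repr_apply_apply, hb0]
    · simp
  · have h1 := (volume_preserving_piFinSuccAbove (fun _ : Fin (k + 1) => ℝ) 0).symm
    have h2 : MeasurePreserving (Prod.map id WithLp.ofLp :
        ℝ × EuclideanSpace ℝ (Fin k) → ℝ × (Fin k → ℝ)) :=
      (MeasurePreserving.id volume).prod (PiLp.volume_preserving_ofLp (Fin k))
    have h3 := b.measurePreserving_repr_symm.comp
      ((PiLp.volume_preserving_toLp (Fin (k + 1))).comp (h1.comp h2))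
    have h4 : (fun p : ℝ × EuclideanSpace ℝ (Fin k) => p.1 • n + ι p.2) =
        b.repr.symm ∘ WithLp.toLp 2 ∘
          (MeasurableEquiv.piFinSuccAbove (fun _ : Fin (k + 1) => ℝ) 0).symm ∘
          Prod.map id WithLp.ofLp := by
      funext p
      simp [hsplit, MeasurableEquiv.piFinSuccAbove, Fin.insertNthEquiv]
    rw [h4]
    exact h3

section Slices

variable {k : ℕ} {n : EuclideanSpace ℝ (Fin (k + 1))}
  {ι : EuclideanSpace ℝ (Fin k) →ₗᵢ[ℝ] EuclideanSpace ℝ (Fin (k + 1))}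

theorem inner_smul_add_isometry (hn : ‖n‖ = 1) (hι : ∀ y, inner ℝ n (ι y) = 0) (s : ℝ)
    (y : EuclideanSpace ℝ (Fin k)) : inner ℝ n (s • n + ι y) = s := by
  simp [inner_add_right, inner_smul_right, hι, hn]

theorem euclideanHausdorffMeasure_slice (hn : ‖n‖ = 1) (hι : ∀ y, inner ℝ n (ι y) = 0)
    {π : EuclideanSpace ℝ (Fin (k + 1)) → EuclideanSpace ℝ (Fin k)}
    (hπ : ∀ x, (inner ℝ n x : ℝ) • n + ι (π x) = x)
    (A : Set (EuclideanSpace ℝ (Fin (k + 1)))) (s : ℝ) :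
    Measure.euclideanHausdorffMeasure k (A ∩ {x | inner ℝ n x = s}) =
      volume {y | s • n + ι y ∈ A} := by
  have hiso : Isometry fun y => s • n + ι y :=
    (isometry_add_left (s • n)).comp ι.isometry
  rw [← EuclideanSpace.euclideanHausdorffMeasure_eq_volume,
    ← hiso.euclideanHausdorffMeasure_image]
  congr 1
  ext x
  constructor
  · rintro ⟨hx, rfl⟩
    exact ⟨π x, by simpa only [Set.mem_ofPred_eq, hπ] using hx, hπ x⟩
  · rintro ⟨y, hy, rfl⟩
    exact ⟨hy, inner_smul_add_isometry hn hι s y⟩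

end Slices

theorem face_eq_inter {m : ℕ} {P : Set (EuclideanSpace ℝ (Fin m))} {n : EuclideanSpace ℝ (Fin m)}
    {h : ℝ} (hh : IsGreatest ((fun x => inner ℝ n x) '' P) h) :
    face P n = P ∩ {x | inner ℝ n x = h} := by
  obtain ⟨⟨z, hz, hzh⟩, hub⟩ := hh
  ext x
  constructor
  · rintro ⟨hx, hmax⟩
    exact ⟨hx, le_antisymm (hub ⟨x, hx, rfl⟩) (hzh ▸ hmax z hz)⟩
  · rintro ⟨hx, hxh⟩
    exact ⟨hx, fun y hy => (hub ⟨y, hy, rfl⟩).trans_eq hxh.symm⟩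

theorem IsCompact.face {m : ℕ} {P : Set (EuclideanSpace ℝ (Fin m))} (hP : IsCompact P)
    (n : EuclideanSpace ℝ (Fin m)) : IsCompact (face P n) := by
  have : BlaschkePolyhedra.face P n = P ∩ ⋂ y ∈ P, {x | inner ℝ n y ≤ inner ℝ n x} := by
    ext x
    simp [BlaschkePolyhedra.face]
  rw [this]
  exact hP.inter_right (isClosed_biInter fun y _ =>
    isClosed_le continuous_const (by fun_prop))

/-! ### Cones over faces: a lower bound for the volume of P -/

/-- The cone with apex `0` over the face of `P` with outward normal `n`. -/
def faceCone {m : ℕ} (P : Set (EuclideanSpace ℝ (Fin m))) (n : EuclideanSpace ℝ (Fin m)) :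
    Set (EuclideanSpace ℝ (Fin m)) :=
  (fun p : ℝ × EuclideanSpace ℝ (Fin m) => p.1 • p.2) '' (Set.Icc 0 1 ×ˢ face P n)

theorem isCompact_faceCone {m : ℕ} {P : Set (EuclideanSpace ℝ (Fin m))} (hP : IsCompact P)
    (n : EuclideanSpace ℝ (Fin m)) : IsCompact (faceCone P n) :=
  (isCompact_Icc.prod (IsCompact.face hP n)).image (by fun_prop)

theorem faceCone_subset {m : ℕ} {P : Set (EuclideanSpace ℝ (Fin m))} (hP : Convex ℝ P)
    (h0 : 0 ∈ P) (n : EuclideanSpace ℝ (Fin m)) : faceCone P n ⊆ P := by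
  rintro _ ⟨⟨r, z⟩, ⟨hr, hz⟩, rfl⟩
  exact hP.smul_mem_of_zero_mem h0 hz.1 hr

theorem lintegral_Ioo_div_pow {h : ℝ} (hh : 0 < h) (k : ℕ) :
    ∫⁻ s in Set.Ioo 0 h, ENNReal.ofReal ((s / h) ^ k) = ENNReal.ofReal (h / (k + 1)) := by
  rw [← ofReal_integral_eq_lintegral_ofReal]
  · rw [← integral_Ioc_eq_integral_Ioo, ← intervalIntegral.integral_of_le hh.le]
    simp only [div_pow, intervalIntegral.integral_div, integral_pow]
    congr 1
    have : h ^ k ≠ 0 := by positivity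
    field_simp
    simp [pow_succ]
  · exact ((by fun_prop : Continuous fun s : ℝ => (s / h) ^ k).integrableOn_Icc).mono_set
      Set.Ioo_subset_Icc_self
  · filter_upwards [ae_restrict_mem measurableSet_Ioo] with s hs
    exact pow_nonneg (div_nonneg hs.1.le hh.le) k

/-- At height 0 < s < h the cone contains the face scaled by s / h, of measure (s / h) ^ k times
that of the face; integrate over s. -/
theorem volume_faceCone_ge {k : ℕ} {P : Set (EuclideanSpace ℝ (Fin (k + 1)))} (hP : IsCompact P)
    {n : EuclideanSpace ℝ (Fin (k + 1))} (hn : ‖n‖ = 1) {h : ℝ} (hh : 0 < h)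
    (hmax : IsGreatest ((fun x => inner ℝ n x) '' P) h) :
    ENNReal.ofReal (h / (k + 1)) * Measure.euclideanHausdorffMeasure k (face P n) ≤
      volume (faceCone P n) := by
  obtain ⟨ι, π, -, hι, hπ, hmp⟩ := exists_isometry_orthogonal hn
  have hCm := (isCompact_faceCone hP n).measurableSet
  have hface := face_eq_inter hmax
  rw [hface, euclideanHausdorffMeasure_slice hn hι hπ, ← hmp.measure_preimage
    hCm.nullMeasurableSet, Measure.volume_eq_prod, Measure.prod_apply (hmp.measurable hCm),
    ← lintegral_Ioo_div_pow hh, ← lintegral_mul_const _ (by fun_prop)]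
  refine (setLIntegral_mono' measurableSet_Ioo fun s hs => ?_).trans
    (setLIntegral_le_lintegral (Set.Ioo 0 h) _)
  have hr : 0 < s / h := div_pos hs.1 hh
  have h1 := Measure.addHaar_smul (volume : Measure (EuclideanSpace ℝ (Fin k))) (s / h)
    {y | h • n + ι y ∈ P}
  rw [finrank_euclideanSpace_fin, abs_of_pos (pow_pos hr k)] at h1
  rw [← h1]
  refine measure_mono ?_
  rintro _ ⟨y, hy, rfl⟩
  refine ⟨(s / h, h • n + ι y), ⟨⟨hr.le, (div_le_one hh).2 hs.2.le⟩, ?_⟩, ?_⟩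
  · rw [hface]
    exact ⟨hy, inner_smul_add_isometry hn hι h y⟩
  · simp only [smul_add, smul_smul, div_mul_cancel₀ s hh.ne', map_smul]

/-- On the cone over the face of n, ⟪n, x⟫ / h dominates ⟪n', x⟫ / h', and conversely on the other
cone. On the intersection they agree, which confines it to a hyperplane. -/
theorem aedisjoint_faceCone {m : ℕ} {P : Set (EuclideanSpace ℝ (Fin m))}
    {n n' : EuclideanSpace ℝ (Fin m)} (hn : ‖n‖ = 1) (hn' : ‖n'‖ = 1) (hne : n ≠ n') {h h' : ℝ}
    (hh : 0 < h) (hh' : 0 < h') (hmax : IsGreatest ((fun x => inner ℝ n x) '' P) h)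
    (hmax' : IsGreatest ((fun x => inner ℝ n' x) '' P) h') :
    AEDisjoint volume (faceCone P n) (faceCone P n') := by
  set w := h⁻¹ • n - h'⁻¹ • n' with hw
  have hw0 : w ≠ 0 := by
    intro h0
    have h1 : h⁻¹ • n = h'⁻¹ • n' := sub_eq_zero.1 h0
    have h2 : h⁻¹ = h'⁻¹ := by
      have := congrArg norm h1
      simpa [norm_smul, hn, hn', abs_of_pos hh, abs_of_pos hh'] using this
    rw [h2] at h1
    exact hne (smul_right_injective _ (inv_ne_zero hh'.ne') h1)
  refine measure_mono_null (t := ((ℝ ∙ w)ᗮ : Submodule ℝ _)) ?_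
    (Measure.addHaar_submodule _ _ fun htop => hw0 ?_)
  · have key : ∀ {u v : EuclideanSpace ℝ (Fin m)} {a b : ℝ}, 0 < a → 0 < b →
        IsGreatest ((fun x => inner ℝ u x) '' P) a → IsGreatest ((fun x => inner ℝ v x) '' P) b →
        ∀ x ∈ faceCone P u, b⁻¹ * inner ℝ v x ≤ a⁻¹ * inner ℝ u x := by
      rintro u v a b ha hb hu hv _ ⟨⟨r, z⟩, ⟨hr, hz⟩, rfl⟩
      have h1 : inner ℝ u z = a := (face_eq_inter hu ▸ hz : z ∈ P ∩ _).2
      have h2 : inner ℝ v z ≤ b := hv.2 ⟨z, hz.1, rfl⟩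
      simp only [inner_smul_right, h1]
      calc b⁻¹ * (r * inner ℝ v z) ≤ b⁻¹ * (r * b) := by
            gcongr
            exact hr.1
        _ = a⁻¹ * (r * a) := by field_simp
    rintro x ⟨hx, hx'⟩
    rw [SetLike.mem_coe, Submodule.mem_orthogonal_singleton_iff_inner_right, hw, inner_sub_left,
      real_inner_smul_left, real_inner_smul_left, sub_eq_zero]
    exact le_antisymm (key hh' hh hmax' hmax x hx') (key hh hh' hmax hmax' x hx)
  · have : w ∈ (ℝ ∙ w)ᗮ := htop ▸ Submodule.mem_top
    rwa [Submodule.mem_orthogonal_singleton_iff_inner_right, inner_self_eq_zero] at this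

theorem sum_support_mul_face_le_volume {k : ℕ} {P : Set (EuclideanSpace ℝ (Fin (k + 1)))}
    (hP : IsCompact P) (hPconv : Convex ℝ P) (h0 : 0 ∈ P)
    (S : Finset (EuclideanSpace ℝ (Fin (k + 1)))) (hS : ∀ n ∈ S, ‖n‖ = 1)
    {h : EuclideanSpace ℝ (Fin (k + 1)) → ℝ} (hh : ∀ n ∈ S, 0 < h n)
    (hmax : ∀ n ∈ S, IsGreatest ((fun x => inner ℝ n x) '' P) (h n)) :
    ∑ n ∈ S, ENNReal.ofReal (h n / (k + 1)) * Measure.euclideanHausdorffMeasure k (face P n) ≤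
      volume P := by
  calc _ ≤ ∑ n ∈ S, volume (faceCone P n) :=
        Finset.sum_le_sum fun n hn => volume_faceCone_ge hP (hS n hn) (hh n hn) (hmax n hn)
    _ = volume (⋃ n ∈ S, faceCone P n) :=
        (measure_biUnion_finset₀ (fun n hn n' hn' hne => aedisjoint_faceCone (hS n hn) (hS n' hn')
          hne (hh n hn) (hh n' hn') (hmax n hn) (hmax n' hn'))
          fun n _ => (isCompact_faceCone hP n).measurableSet.nullMeasurableSet).symm
    _ ≤ volume P := measure_mono (Set.iUnion₂_subset fun n _ => faceCone_subset hPconv h0 n)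

/-! ### Growth of Q + t P beyond a face of Q -/

theorem euclideanHausdorffMeasure_face_ne_top {k : ℕ} {Q : Set (EuclideanSpace ℝ (Fin (k + 1)))}
    (hQ : IsCompact Q) (hQ0 : Q.Nonempty) {n : EuclideanSpace ℝ (Fin (k + 1))} (hn : ‖n‖ = 1) :
    Measure.euclideanHausdorffMeasure k (face Q n) ≠ ∞ := by
  obtain ⟨a, ha⟩ := (hQ.image (f := fun x => inner ℝ n x) (by fun_prop)).exists_isGreatest
    (hQ0.image _)
  obtain ⟨ι, π, -, hι, hπ, -⟩ := exists_isometry_orthogonal hn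
  rw [face_eq_inter ha, euclideanHausdorffMeasure_slice hn hι hπ]
  have hiso : Isometry fun y => a • n + ι y := (isometry_add_left (a • n)).comp ι.isometry
  exact (hiso.isClosedEmbedding.isCompact_preimage hQ).measure_lt_top.ne

/-- The part of `Q + t • P` beyond the supporting hyperplane of `Q` with normal `n` has volume
at most `t * h * g`, where `h` is the support function of `P` at `n` and `g` tends to the volume of
the face of `Q` with normal `n` as `t` tends to `0`. -/
theorem exists_volume_beyond_face_le {k : ℕ} {P Q : Set (EuclideanSpace ℝ (Fin (k + 1)))}
    (hP : IsCompact P) (hPconv : Convex ℝ P) (h0 : 0 ∈ P) (hQ : IsCompact Q)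
    {n : EuclideanSpace ℝ (Fin (k + 1))} (hn : ‖n‖ = 1) {h a : ℝ}
    (hh : IsGreatest ((fun x => inner ℝ n x) '' P) h)
    (ha : IsGreatest ((fun x => inner ℝ n x) '' Q) a)
    {t : ℕ → ℝ} (ht : ∀ j, 0 < t j) (htanti : Antitone t) (htlim : Tendsto t atTop (𝓝 0)) :
    ∃ g : ℕ → ℝ≥0∞, (∀ j, g j ≠ ∞) ∧
      Tendsto g atTop (𝓝 (Measure.euclideanHausdorffMeasure k (face Q n))) ∧
      ∀ j, volume ((Q + t j • P) ∩ {x | a < inner ℝ n x}) ≤ ENNReal.ofReal (t j * h) * g j := by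
  obtain ⟨ι, π, hπc, hι, hπ, hmp⟩ := exists_isometry_orthogonal hn
  have hπι : ∀ (s : ℝ) y, π (s • n + ι y) = y := by
    intro s y
    have h1 := hπ (s • n + ι y)
    rw [inner_smul_add_isometry hn hι] at h1
    exact ι.injective (add_left_cancel h1)
  have hAc : ∀ j, IsCompact (Q + t j • P) := fun j => hQ.add (hP.smul (t j))
  have hclosed : IsClosed {x : EuclideanSpace ℝ (Fin (k + 1)) | a ≤ inner ℝ n x} :=
    isClosed_le continuous_const (by fun_prop)
  -- B j is the shadow on n^⊥ of the part of Q + t j • P at height at least a. These compact sets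
  -- decrease to the shadow of the face, and g j is the volume of B j.
  set B : ℕ → Set (EuclideanSpace ℝ (Fin k)) :=
    fun j => π '' ((Q + t j • P) ∩ {x | a ≤ inner ℝ n x}) with hB
  have hBc : ∀ j, IsCompact (B j) := fun j => ((hAc j).inter_right hclosed).image hπc
  have hbound : ∀ j, ∀ x ∈ Q + t j • P, inner ℝ n x ≤ a + t j * h := by
    rintro j _ ⟨q, hq, _, ⟨p, hp, rfl⟩, rfl⟩
    have h1 : inner ℝ n q ≤ a := ha.2 ⟨q, hq, rfl⟩
    have h2 : inner ℝ n p ≤ h := hh.2 ⟨p, hp, rfl⟩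
    simp only [inner_add_right, inner_smul_right]
    exact add_le_add h1 (mul_le_mul_of_nonneg_left h2 (ht j).le)
  refine ⟨fun j => volume (B j), fun j => (hBc j).measure_lt_top.ne, ?_, fun j => ?_⟩
  · have hanti : Antitone B := by
      intro i j hij
      refine Set.image_mono (Set.inter_subset_inter_left _ (Set.add_subset_add_left ?_))
      rintro _ ⟨p, hp, rfl⟩
      refine ⟨(t j / t i) • p, hPconv.smul_mem_of_zero_mem h0 hp
        ⟨(div_pos (ht j) (ht i)).le, (div_le_one (ht i)).2 (htanti hij)⟩, ?_⟩
      simp only [smul_smul, mul_div_cancel₀ _ (ht i).ne']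
    have hlim := tendsto_measure_iInter_atTop (μ := volume)
      (fun j => (hBc j).measurableSet.nullMeasurableSet) hanti ⟨0, (hBc 0).measure_lt_top.ne⟩
    suffices hface : Measure.euclideanHausdorffMeasure k (face Q n) = volume (⋂ j, B j) by
      rw [hface]
      exact hlim
    rw [face_eq_inter ha, euclideanHausdorffMeasure_slice hn hι hπ]
    congr 1
    ext y
    rw [Set.mem_iInter]
    constructor
    · intro hy j
      refine ⟨a • n + ι y, ⟨⟨a • n + ι y, hy, 0, ⟨0, h0, smul_zero _⟩, add_zero _⟩, ?_⟩, hπι a y⟩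
      exact (inner_smul_add_isometry hn hι a y).ge
    · intro hy
      change a • n + ι y ∈ Q
      choose x hx hxy using hy
      choose q hq r hr hqr using fun j => (hx j).1
      choose p hp hpr using hr
      obtain ⟨R, hR⟩ := hP.isBounded.exists_norm_le
      refine hQ.isClosed.mem_of_tendsto (f := q) (b := atTop) ?_ (Eventually.of_forall hq)
      rw [tendsto_iff_norm_sub_tendsto_zero]
      refine squeeze_zero (fun j => norm_nonneg _) (fun j => ?_)
        (by simpa using htlim.mul_const (h + R))
      -- Since x j projects to y, it differs from a • n + ι y only along n, by at most t j * h.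
      -- Hence q j, its component in Q, tends to a • n + ι y, and Q is closed.
      have h1 : q j - (a • n + ι y) = (inner ℝ n (x j) - a) • n - t j • p j := by
        have h2 := hπ (x j)
        rw [hxy j] at h2
        have h3 : q j = x j - t j • p j := by
          rw [← hqr j, ← hpr j]
          simp
        rw [h3]
        nth_rewrite 1 [← h2]
        rw [sub_smul]
        abel
      rw [h1]
      refine (norm_sub_le _ _).trans ?_
      rw [norm_smul, norm_smul, hn, mul_one, Real.norm_of_nonneg (sub_nonneg.2 (hx j).2),
        Real.norm_of_nonneg (ht j).le, mul_add]
      have := hbound j _ (hx j).1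
      exact add_le_add (by linarith) (mul_le_mul_of_nonneg_left (hR _ (hp j)) (ht j).le)
  · have hmeas : MeasurableSet ((Q + t j • P) ∩ {x | a < inner ℝ n x}) :=
      (hAc j).measurableSet.inter (isOpen_lt continuous_const (by fun_prop)).measurableSet
    rw [← hmp.measure_preimage hmeas.nullMeasurableSet]
    -- In orthogonal coordinates the cap lies in a cylinder of height t j * h over B j.
    calc _ ≤ volume (Set.Ioc a (a + t j * h) ×ˢ B j) := by
          refine measure_mono ?_
          rintro ⟨s, y⟩ ⟨hA, hlt⟩
          have hs : inner ℝ n (s • n + ι y) = s := inner_smul_add_isometry hn hι s y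
          refine ⟨⟨hs ▸ hlt, hs ▸ hbound j _ hA⟩, s • n + ι y, ⟨hA, ?_⟩, hπι s y⟩
          exact le_of_lt (α := ℝ) (show a < inner ℝ n (s • n + ι y) from hlt)
      _ = _ := by
          rw [Measure.volume_eq_prod, Measure.prod_prod, Real.volume_Ioc, add_sub_cancel_left]

/-! ### Minkowski's first inequality -/

/-- Multiplicative Brunn–Minkowski with weights 1 / (1 + t) and t / (1 + t), rescaled by 1 + t. The
exponential form of the geometric mean is ready for differentiation in t. -/
theorem volume_add_smul_ge {m : ℕ} {P Q : Set (EuclideanSpace ℝ (Fin m))}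
    (hP : IsCompact P) (hQ : IsCompact Q) (hP0 : 0 < volume.real P) (hQ0 : 0 < volume.real Q)
    {t : ℝ} (ht : 0 < t) :
    (1 + t) ^ m * Real.exp ((Real.log (volume.real Q) + t * Real.log (volume.real P)) / (1 + t)) ≤
      volume.real (Q + t • P) := by
  have h1 : 0 < 1 + t := by linarith
  have hA : IsCompact (Q + t • P) := hQ.add (hP.smul t)
  have key := volume_rpow_mul_volume_rpow_le (a := 1 / (1 + t)) (b := t / (1 + t)) (by positivity)
    (by positivity) (by field_simp) hQ.measurableSet hP.measurableSet
    (hA.smul (1 + t)⁻¹).measurableSet (by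
      intro x hx y hy
      refine ⟨x + t • y, Set.add_mem_add hx (Set.smul_mem_smul_set hy), ?_⟩
      simp only [smul_add, smul_smul]
      congr 2 <;> field_simp)
  have key2 := ENNReal.toReal_mono (hA.smul (1 + t)⁻¹).measure_lt_top.ne key
  rw [Measure.addHaar_smul, finrank_euclideanSpace_fin, ENNReal.toReal_mul, ENNReal.toReal_mul,
    ← ENNReal.toReal_rpow, ← ENNReal.toReal_rpow, ENNReal.toReal_ofReal (abs_nonneg _),
    abs_of_pos (by positivity), inv_pow] at key2
  change volume.real Q ^ _ * volume.real P ^ _ ≤ _ * volume.real _ at key2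
  rw [← div_eq_inv_mul, le_div_iff₀ (by positivity), Real.rpow_def_of_pos hQ0,
    Real.rpow_def_of_pos hP0, ← Real.exp_add, mul_comm] at key2
  refine le_of_eq_of_le ?_ key2
  congr 2
  ring

/-- A logarithmic form of Minkowski's first inequality for mixed volumes. -/
theorem minkowski_log_le_sum {k : ℕ} {P Q : Set (EuclideanSpace ℝ (Fin (k + 1)))}
    (hP : IsCompact P) (hPconv : Convex ℝ P) (h0 : 0 ∈ P) (hQ : IsCompact Q)
    (hP0 : 0 < volume.real P) (hQ0 : 0 < volume.real Q)
    (S : Finset (EuclideanSpace ℝ (Fin (k + 1)))) (hS : ∀ n ∈ S, ‖n‖ = 1)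
    {h a : EuclideanSpace ℝ (Fin (k + 1)) → ℝ}
    (hh : ∀ n, IsGreatest ((fun x => inner ℝ n x) '' P) (h n))
    (ha : ∀ n, IsGreatest ((fun x => inner ℝ n x) '' Q) (a n))
    (hQS : ∀ x, (∀ n ∈ S, inner ℝ n x ≤ a n) → x ∈ Q) :
    (k + 1) * volume.real Q +
        volume.real Q * (Real.log (volume.real P) - Real.log (volume.real Q)) ≤
      ∑ n ∈ S, h n * (Measure.euclideanHausdorffMeasure k (face Q n)).toReal := by
  set q := volume.real Q
  set p := volume.real P
  let t : ℕ → ℝ := fun j => 1 / ((j : ℝ) + 1)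
  have ht : ∀ j, 0 < t j := fun j => by positivity
  have htanti : Antitone t := fun i j hij => one_div_le_one_div_of_le (by positivity) (by gcongr)
  have htlim : Tendsto t atTop (𝓝 0) := tendsto_one_div_add_atTop_nhds_zero_nat
  have hhn : ∀ n, 0 ≤ h n := fun n => (hh n).2 ⟨0, h0, inner_zero_right _⟩
  have hQne : Q.Nonempty := by
    rw [Set.nonempty_iff_ne_empty]
    rintro rfl
    simp [q] at hQ0
  have hg : ∀ n, ∃ g : ℕ → ℝ≥0∞, n ∈ S → (∀ j, g j ≠ ∞) ∧
      Tendsto g atTop (𝓝 (Measure.euclideanHausdorffMeasure k (face Q n))) ∧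
      ∀ j, volume ((Q + t j • P) ∩ {x | a n < inner ℝ n x}) ≤
        ENNReal.ofReal (t j * h n) * g j := by
    intro n
    by_cases hn : n ∈ S
    · obtain ⟨g, hg⟩ := exists_volume_beyond_face_le hP hPconv h0 hQ (hS n hn) (hh n) (ha n) ht
        htanti htlim
      exact ⟨g, fun _ => hg⟩
    · exact ⟨0, fun hn' => (hn hn').elim⟩
  choose g hg using hg
  -- A point outside Q violates a supporting inequality with normal in S, so Q and the caps beyond
  -- these hyperplanes cover Q + t j • P.
  have hvol : ∀ j, volume.real (Q + t j • P) ≤ q + ∑ n ∈ S, t j * h n * (g n j).toReal := by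
    intro j
    have hfin : ∀ n ∈ S, ENNReal.ofReal (t j * h n) * g n j ≠ ∞ := fun n hn =>
      ENNReal.mul_ne_top ENNReal.ofReal_ne_top ((hg n hn).1 j)
    have h1 : volume (Q + t j • P) ≤
        volume Q + ∑ n ∈ S, ENNReal.ofReal (t j * h n) * g n j := by
      calc volume (Q + t j • P) ≤
            volume (Q ∪ ⋃ n ∈ S, (Q + t j • P) ∩ {x | a n < inner ℝ n x}) := by
            refine measure_mono fun x hx => ?_
            by_cases hxQ : ∀ n ∈ S, inner ℝ n x ≤ a n
            · exact Or.inl (hQS x hxQ)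
            · push Not at hxQ
              obtain ⟨n, hn, hlt⟩ := hxQ
              exact Or.inr (Set.mem_iUnion₂.2 ⟨n, hn, hx, hlt⟩)
        _ ≤ volume Q + ∑ n ∈ S, volume ((Q + t j • P) ∩ {x | a n < inner ℝ n x}) :=
            (measure_union_le _ _).trans (add_le_add_right (measure_biUnion_finset_le S _) _)
        _ ≤ _ := add_le_add_right (Finset.sum_le_sum fun n hn => (hg n hn).2.2 j) _
    have h2 := ENNReal.toReal_mono
      (ENNReal.add_ne_top.2 ⟨hQ.measure_lt_top.ne, ENNReal.sum_ne_top.2 hfin⟩) h1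
    rw [ENNReal.toReal_add hQ.measure_lt_top.ne (ENNReal.sum_ne_top.2 hfin),
      ENNReal.toReal_sum hfin] at h2
    refine h2.trans_eq ?_
    congr 1
    refine Finset.sum_congr rfl fun n _ => ?_
    rw [ENNReal.toReal_mul, ENNReal.toReal_ofReal (mul_nonneg (ht j).le (hhn n))]
  set f : ℝ → ℝ := fun s =>
    (1 + s) ^ (k + 1) * Real.exp ((Real.log q + s * Real.log p) / (1 + s)) with hf
  have hf0 : f 0 = q := by simp [hf, Real.exp_log hQ0]
  -- The lower bound f equals q at 0, as does the upper bound `hvol` formally, so difference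
  -- quotients along t j → 0 can be compared.
  have hderiv : HasDerivAt f ((k + 1) * q + q * (Real.log p - Real.log q)) 0 := by
    have h1 : HasDerivAt (fun s : ℝ => 1 + s) 1 0 := (hasDerivAt_id (0 : ℝ)).const_add 1
    have h2 : HasDerivAt (fun s : ℝ => Real.log q + s * Real.log p) (1 * Real.log p) 0 :=
      ((hasDerivAt_id (0 : ℝ)).mul_const _).const_add _
    have h3 := (h1.pow (k + 1)).mul (h2.div h1 (by simp)).exp
    refine h3.congr_deriv ?_
    simp [Real.exp_log hQ0]
  have hslope : Tendsto (fun j => (t j)⁻¹ * (f (t j) - q)) atTop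
      (𝓝 ((k + 1) * q + q * (Real.log p - Real.log q))) := by
    have h1 := (hasDerivAt_iff_tendsto_slope_zero.1 hderiv).comp
      (tendsto_nhdsWithin_iff.2 ⟨htlim, Eventually.of_forall fun j => (ht j).ne'⟩)
    simpa only [Function.comp_def, zero_add, hf0, smul_eq_mul] using h1
  have hsum : Tendsto (fun j => ∑ n ∈ S, h n * (g n j).toReal) atTop
      (𝓝 (∑ n ∈ S, h n * (Measure.euclideanHausdorffMeasure k (face Q n)).toReal)) :=
    tendsto_finsetSum S fun n hn => ((ENNReal.tendsto_toReal
      (euclideanHausdorffMeasure_face_ne_top hQ hQne (hS n hn))).comp (hg n hn).2.1).const_mul _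
  refine le_of_tendsto_of_tendsto' hslope hsum fun j => ?_
  have h1 : f (t j) - q ≤ t j * ∑ n ∈ S, h n * (g n j).toReal := by
    have h2 := (volume_add_smul_ge hP hQ hP0 hQ0 (ht j)).trans (hvol j)
    change f (t j) ≤ _ at h2
    rw [Finset.mul_sum]
    simp only [mul_assoc] at h2
    linarith
  rw [inv_mul_le_iff₀ (ht j)]
  exact h1

/-! ### Comparison of the volumes -/

theorem volume_le_of_euclideanHausdorffMeasure_face_le {k : ℕ} (hk : k ≠ 0)
    {P Q : Set (EuclideanSpace ℝ (Fin (k + 1)))}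
    (hP : IsCompact P) (hPconv : Convex ℝ P) (h0 : 0 ∈ interior P)
    (hQ : IsCompact Q) (hQi : (interior Q).Nonempty)
    (S : Finset (EuclideanSpace ℝ (Fin (k + 1)))) (hS : ∀ n ∈ S, ‖n‖ = 1)
    (hQS : ∀ x, (∀ n ∈ S, ∃ y ∈ Q, inner ℝ n x ≤ inner ℝ n y) → x ∈ Q)
    (hfaces : ∀ n ∈ S, Measure.euclideanHausdorffMeasure k (face Q n) ≤
      Measure.euclideanHausdorffMeasure k (face P n)) :
    volume Q ≤ volume P := by
  have hPne : P.Nonempty := ⟨0, interior_subset h0⟩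
  have hQne : Q.Nonempty := hQi.mono interior_subset
  have hmaxP := fun n : EuclideanSpace ℝ (Fin (k + 1)) =>
    (hP.image (f := fun x => inner ℝ n x) (by fun_prop)).exists_isGreatest (hPne.image _)
  have hmaxQ := fun n : EuclideanSpace ℝ (Fin (k + 1)) =>
    (hQ.image (f := fun x => inner ℝ n x) (by fun_prop)).exists_isGreatest (hQne.image _)
  choose h hh using hmaxP
  choose a ha using hmaxQ
  have hpos : ∀ n ∈ S, 0 < h n := by
    intro n hn
    obtain ⟨ε, hε, hball⟩ := Metric.mem_nhds_iff.1 (mem_interior_iff_mem_nhds.1 h0)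
    have hmem : (ε / 2) • n ∈ P := hball (by
      simp only [mem_ball_zero_iff, norm_smul, hS n hn, mul_one, Real.norm_eq_abs]
      rw [abs_of_pos (by positivity)]
      linarith)
    have h1 : inner ℝ n ((ε / 2) • n) ≤ h n := (hh n).2 ⟨_, hmem, rfl⟩
    rw [inner_smul_right, real_inner_self_eq_norm_sq, hS n hn] at h1
    linarith
  have hp : 0 < volume.real P := ENNReal.toReal_pos
    (Measure.measure_pos_of_nonempty_interior volume ⟨0, h0⟩).ne' hP.measure_lt_top.ne
  have hq : 0 < volume.real Q := ENNReal.toReal_pos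
    (Measure.measure_pos_of_nonempty_interior volume hQi).ne' hQ.measure_lt_top.ne
  set p := volume.real P with hp_def
  set q := volume.real Q with hq_def
  -- This scale makes the cone bound c (k + 1) p equal to (k + 1) q, cancelling the leading term of
  -- Minkowski's inequality for c • P and Q.
  set c := q / p with hc
  have hc0 : 0 < c := div_pos hq hp
  have hFP : ∀ n ∈ S, Measure.euclideanHausdorffMeasure k (face P n) ≠ ∞ := fun n hn =>
    euclideanHausdorffMeasure_face_ne_top hP hPne (hS n hn)
  have hcone : ∑ n ∈ S, h n * (Measure.euclideanHausdorffMeasure k (face P n)).toReal ≤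
      (k + 1) * p := by
    have hfin : ∀ n ∈ S, ENNReal.ofReal (h n / (k + 1)) *
        Measure.euclideanHausdorffMeasure k (face P n) ≠ ∞ := fun n hn =>
      ENNReal.mul_ne_top ENNReal.ofReal_ne_top (hFP n hn)
    have h1 := ENNReal.toReal_mono hP.measure_lt_top.ne
      (sum_support_mul_face_le_volume hP hPconv (interior_subset h0) S hS hpos fun n _ => hh n)
    rw [ENNReal.toReal_sum hfin] at h1
    change _ ≤ p at h1
    rw [← div_le_iff₀' (by positivity), Finset.sum_div]
    refine (Finset.sum_congr rfl fun n hn => ?_).trans_le h1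
    rw [ENNReal.toReal_mul, ENNReal.toReal_ofReal (div_nonneg (hpos n hn).le (by positivity))]
    ring
  have hvol : volume.real (c • P) = c ^ (k + 1) * p := by
    rw [Measure.real, Measure.addHaar_smul, finrank_euclideanSpace_fin,
      abs_of_pos (by positivity), ENNReal.toReal_mul, ENNReal.toReal_ofReal (by positivity)]
    rfl
  have hsmul : ∀ n, IsGreatest ((fun x => inner ℝ n x) '' (c • P)) (c * h n) := by
    intro n
    obtain ⟨⟨z, hz, hzh⟩, hub⟩ := hh n
    refine ⟨⟨c • z, Set.smul_mem_smul_set hz, ?_⟩, ?_⟩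
    · simp only [inner_smul_right] at hzh ⊢
      rw [hzh]
    · rintro _ ⟨_, ⟨x, hx, rfl⟩, rfl⟩
      simp only [inner_smul_right]
      exact mul_le_mul_of_nonneg_left (hub ⟨x, hx, rfl⟩) hc0.le
  have hmink := minkowski_log_le_sum (hP.smul c) (hPconv.smul c)
    ⟨0, interior_subset h0, smul_zero c⟩ hQ (by rw [hvol]; positivity) hq S hS hsmul ha
    fun x hx => hQS x fun n hn => by
      obtain ⟨y, hy, hya⟩ := (ha n).1
      exact ⟨y, hy, (hx n hn).trans_eq hya.symm⟩
  rw [hvol, ← hq_def] at hmink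
  have hle : ∑ n ∈ S, c * h n * (Measure.euclideanHausdorffMeasure k (face Q n)).toReal ≤
      (k + 1) * q := by
    calc _ ≤ ∑ n ∈ S, c * (h n * (Measure.euclideanHausdorffMeasure k (face P n)).toReal) := by
          refine Finset.sum_le_sum fun n hn => ?_
          rw [mul_assoc]
          have := ENNReal.toReal_mono (hFP n hn) (hfaces n hn)
          have := (hpos n hn).le
          gcongr
      _ ≤ c * ((k + 1) * p) := by
          rw [← Finset.mul_sum]
          gcongr
      _ = (k + 1) * q := by
          rw [hc]
          field_simp
  have hlog : Real.log (c ^ (k + 1) * p) ≤ Real.log q := by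
    have h1 : q * (Real.log (c ^ (k + 1) * p) - Real.log q) ≤ 0 := by linarith
    exact sub_nonpos.1 (nonpos_of_mul_nonpos_right h1 hq)
  -- Since c p = q, the bound c ^ (k + 1) p ≤ q reads c ^ k q ≤ q.
  have h1 : c ^ k * q ≤ 1 * q := by
    have h2 := (Real.log_le_log_iff (by positivity) hq).1 hlog
    have h3 : c * p = q := div_mul_cancel₀ q hp.ne'
    rwa [pow_succ, mul_assoc, h3, ← one_mul q, ← mul_assoc, mul_one] at h2
  have h2 : c ≤ 1 := (pow_le_one_iff_of_nonneg hc0.le hk).1 (le_of_mul_le_mul_right h1 hq)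
  have h3 : q ≤ p := (div_le_one hp).1 h2
  exact (ENNReal.toReal_le_toReal hQ.measure_lt_top.ne hP.measure_lt_top.ne).1 h3

/-! ### Polyhedra, facet normals and the theorem -/

theorem IsConvexPolyhedron.convex {m : ℕ} {P : Set (EuclideanSpace ℝ (Fin m))}
    (hP : IsConvexPolyhedron P) : Convex ℝ P := by
  obtain ⟨s, -, rfl⟩ := hP
  intro x hx y hy α β hα hβ hαβ u hu
  rw [inner_add_right, inner_smul_right, inner_smul_right]
  calc _ ≤ α * u.2 + β * u.2 := add_le_add (mul_le_mul_of_nonneg_left (hx u hu) hα)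
        (mul_le_mul_of_nonneg_left (hy u hu) hβ)
    _ = u.2 := by rw [← add_mul, hαβ, one_mul]

theorem convex_face {m : ℕ} {P : Set (EuclideanSpace ℝ (Fin m))} (hP : Convex ℝ P)
    (n : EuclideanSpace ℝ (Fin m)) : Convex ℝ (face P n) := by
  intro x hx y hy α β hα hβ hαβ
  refine ⟨hP hx.1 hy.1 hα hβ hαβ, fun z hz => ?_⟩
  rw [inner_add_right, inner_smul_right, inner_smul_right]
  calc inner ℝ n z = α * inner ℝ n z + β * inner ℝ n z := by rw [← add_mul, hαβ, one_mul]
    _ ≤ _ := add_le_add (mul_le_mul_of_nonneg_left (hx.2 z hz) hα)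
        (mul_le_mul_of_nonneg_left (hy.2 z hz) hβ)

theorem direction_face_le {m : ℕ} (P : Set (EuclideanSpace ℝ (Fin m)))
    (n : EuclideanSpace ℝ (Fin m)) :
    (affineSpan ℝ (face P n)).direction ≤ (ℝ ∙ n)ᗮ := by
  rw [direction_affineSpan, vectorSpan_def, Submodule.span_le]
  rintro _ ⟨x, hx, y, hy, rfl⟩
  rw [SetLike.mem_coe, Submodule.mem_orthogonal_singleton_iff_inner_right]
  change inner ℝ n (x - y) = 0
  rw [inner_sub_right, sub_eq_zero]
  exact le_antisymm (hy.2 x hx.1) (hx.2 y hy.1)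

/-- The face lies in a hyperplane orthogonal to n; if it is not a facet, its dimension is below k,
and a convex set has Hausdorff dimension equal to its affine dimension. -/
theorem euclideanHausdorffMeasure_face_eq_zero {k : ℕ}
    {P : Set (EuclideanSpace ℝ (Fin (k + 1)))} (hP : Convex ℝ P)
    {n : EuclideanSpace ℝ (Fin (k + 1))} (hn : ‖n‖ = 1) (hnP : n ∉ facetNormals P) :
    Measure.euclideanHausdorffMeasure k (face P n) = 0 := by
  rcases (face P n).eq_empty_or_nonempty with he | hne
  · simp [he]
  have hn0 : n ≠ 0 := by
    rintro rfl
    simp at hn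
  have hfin : Module.finrank ℝ (ℝ ∙ n)ᗮ = k := by
    have : Fact (Module.finrank ℝ (EuclideanSpace ℝ (Fin (k + 1))) = k + 1) := ⟨by simp⟩
    exact Submodule.finrank_orthogonal_span_singleton hn0
  have hle := Submodule.finrank_mono (direction_face_le P n)
  have hlt : Module.finrank ℝ (affineSpan ℝ (face P n)).direction < k := by
    refine lt_of_le_of_ne (hle.trans_eq hfin) fun h => hnP ⟨hn, by rw [h]⟩
  have hdim : dimH (face P n) < ((k : NNReal) : ℝ≥0∞) := by
    rw [Real.Convex.dimH_eq_finrank_vectorSpan (convex_face hP n) hne, ← direction_affineSpan]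
    exact_mod_cast hlt
  have := hausdorffMeasure_of_dimH_lt hdim
  rw [Measure.euclideanHausdorffMeasure_def, Measure.smul_apply]
  simp only [NNReal.coe_natCast] at this
  rw [this, smul_zero]

/-- The normals of any defining half-spaces serve, redundant ones included. Comparing with points of
Q replaces the given constants by support values, which are at least as strict. -/
theorem IsConvexPolyhedron.exists_unit_normals {m : ℕ} {Q : Set (EuclideanSpace ℝ (Fin m))}
    (hQ : IsConvexPolyhedron Q) :
    ∃ S : Finset (EuclideanSpace ℝ (Fin m)), (∀ n ∈ S, ‖n‖ = 1) ∧
      ∀ x, (∀ n ∈ S, ∃ y ∈ Q, inner ℝ n x ≤ inner ℝ n y) → x ∈ Q := by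
  classical
  obtain ⟨s, hs, rfl⟩ := hQ
  refine ⟨s.image fun u => ‖u.1‖⁻¹ • u.1, ?_, fun x hx u hu => ?_⟩
  · intro n hn
    obtain ⟨u, hu, rfl⟩ := Finset.mem_image.1 hn
    exact norm_smul_inv_norm (𝕜 := ℝ) (hs u hu)
  · obtain ⟨y, hy, hxy⟩ := hx _ (Finset.mem_image_of_mem _ hu)
    rw [real_inner_smul_left, real_inner_smul_left] at hxy
    exact (le_of_mul_le_mul_left hxy (inv_pos.2 (norm_pos_iff.2 (hs u hu)))).trans (hy u hu)

theorem face_vadd {m : ℕ} (P : Set (EuclideanSpace ℝ (Fin m))) (v n : EuclideanSpace ℝ (Fin m)) :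
    face (v +ᵥ P) n = v +ᵥ face P n := by
  ext x
  simp only [Set.mem_vadd_set, face, Set.mem_ofPred_eq, vadd_eq_add]
  constructor
  · rintro ⟨⟨z, hz, rfl⟩, hmax⟩
    refine ⟨z, ⟨hz, fun y hy => ?_⟩, rfl⟩
    simpa [inner_add_right] using hmax (v + y) ⟨y, hy, rfl⟩
  · rintro ⟨z, ⟨hz, hmax⟩, rfl⟩
    refine ⟨⟨z, hz, rfl⟩, ?_⟩
    rintro _ ⟨y, hy, rfl⟩
    simpa [inner_add_right] using hmax y hy

end BlaschkePolyhedra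

open scoped Pointwise

theorem corollary7p2 (m : ℕ) (hm : 2 ≤ m) (P Q : Set (EuclideanSpace ℝ (Fin m)))
    (hP : BlaschkePolyhedra.IsConvexPolyhedron P) (hPc : IsCompact P)
    (hPi : (interior P).Nonempty)
    (hQ : BlaschkePolyhedra.IsConvexPolyhedron Q) (hQc : IsCompact Q)
    (hQi : (interior Q).Nonempty)
    (hfaces : ∀ n ∈ BlaschkePolyhedra.facetNormals P ∪ BlaschkePolyhedra.facetNormals Q,
      Measure.euclideanHausdorffMeasure (m - 1) (BlaschkePolyhedra.face Q n) ≤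
        Measure.euclideanHausdorffMeasure (m - 1) (BlaschkePolyhedra.face P n)) :
    volume Q ≤ volume P := by
  obtain ⟨k, rfl⟩ : ∃ k, m = k + 1 := ⟨m - 1, by omega⟩
  rw [Nat.add_sub_cancel] at hfaces
  obtain ⟨x₀, hx₀⟩ := hPi
  obtain ⟨S, hS, hQS⟩ := hQ.exists_unit_normals
  -- Translation changes neither volumes nor face measures, and puts the apex of the cones inside P.
  have h0 : (0 : EuclideanSpace ℝ (Fin (k + 1))) ∈ interior (-x₀ +ᵥ P) := by
    rw [interior_vadd]
    exact ⟨x₀, hx₀, by simp⟩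
  have key := BlaschkePolyhedra.volume_le_of_euclideanHausdorffMeasure_face_le
    (by omega) (hPc.vadd (-x₀)) (hP.convex.vadd (-x₀)) h0 hQc hQi S hS hQS fun n hn => by
      rw [BlaschkePolyhedra.face_vadd, measure_vadd]
      by_cases hnQ : n ∈ BlaschkePolyhedra.facetNormals Q
      · exact hfaces n (Or.inr hnQ)
      · rw [BlaschkePolyhedra.euclideanHausdorffMeasure_face_eq_zero hQ.convex (hS n hn) hnQ]
        exact bot_le
  rwa [measure_vadd] at key
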